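/- Let $k$ be a field and let $\Lambda = kQ/I$ be a gentle algebra: $Q$ is a finite quiver, $I$ is an admissible ideal generated by paths of length two, at most two arrows start and at most two arrows end at each vertex, and for each arrow $a$ there is at most one arrow $b$ with $ba$ a path not in $I$, at most one arrow $b$ with $ba$ a path in $I$, and dually for the composites $ac$. A homotopy letter is a nontrivial path $p$ in $(Q,I)$ (a direct letter) or its formal inverse $\bar p$ (an inverse letter). A homotopy band is a cyclic word $\sigma=\sigma_n\cdots\sigma_1$ of composable homotopy letters, not a proper power, in which consecutive direct (or consecutive inverse) letters are separated by a relation and adjacent letters of opposite orientation do not cancel, together with cohomological degrees on its vertices, such that a direct letter $p\colon x\to y$ gives a component $P(y)\to P(x)$ of degree one and an inverse letter $\bar p$ with $p\colon x\to y$ likewise gives a component $P(y)\to P(x)$ of degree one. For $\lambda\in k^*$, the band complex $B_{\sigma,\lambda}$ is the complex of projective $\Lambda$-modules whose differential has these components, one of the direct letters being multiplied by $\lambda$. Its unfolded diagram is written on the two-sided infinite word ${}^\infty\sigma^\infty$, all copies of a summand being identified. Let $(\sigma,\lambda)$ and $(\tau,\mu)$ be homotopy bands with $\lambda,\mu\in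 k^*$ placed on direct letters. An overlap is a maximal common homotopy substring $\rho$, in the same cohomological degrees, of the words ${}^\infty\sigma^\infty$ and ${}^\infty\tau^\infty$, where one of the two words may have to be inverted. A graph map $B_{\sigma,\lambda}\to B_{\tau,\mu}$ determined by $\rho$ is a chain map whose components are nonzero multiples of identities along $\rho$ and, at an end of $\rho$, either a nonzero multiple of the class of a nontrivial path completing a square that commutes up to scalars, or zero if there the component of the differential of $B_{\sigma,\lambda}$ points away from $\rho$ and that of $B_{\tau,\mu}$ points into it; there are no other nonzero components. A quasi-graph map $B_{\sigma,\lambda}\rightsquigarrow\Sigma^{-1}B_{\tau,\mu}$ determined by an overlap $\rho$ of the diagrams of $B_{\sigma,\lambda}$ and $\Sigma^{-1}B_{\tau,\mu}$ is a diagram (not necessarily a chain map) of nonzero multiples of identities along $\rho$ for which the squares over $\rho$ commute, where at each end of $\rho$ either the component of the differential of the first complex points into $\rho$ and that of the second points away from it, or both point away from $\rho$ and the path of the first properly extends that of the second at its far end, or both point into $\rho$ and the path of the second properly extends that of the first at its far end. 1. If $f\colon B_{\sigma,\lambda}\to B_{\tau,\mu}$ is a graph map determined by an infinite overlap, then $f$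 is an isomorphism in the derived category of $\Lambda$. Moreover $\lambda=\mu$ if the overlap reads $\sigma$ and $\tau$ in the same direction, and $\lambda=\mu^{-1}$ if it reads them in opposite directions (that is, $\lambda=\mu$ after $(\tau,\mu)$ has been rewritten as $(\bar\tau,\mu^{-1})$, with the scalar again on a direct letter). 2. If $\phi\colon B_{\sigma,\lambda}\rightsquigarrow\Sigma^{-1}B_{\tau,\mu}$ is a quasi-graph map determined by an infinite overlap, then $B_{\sigma,\lambda}\cong\Sigma^{-1}B_{\tau,\mu}$ in the derived category of $\Lambda$, and $\lambda=\mu$ or $\lambda=\mu^{-1}$ according to the direction as in 1. -/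

import Mathlib

open CategoryTheory

namespace Gentle

/-! ### Bound quivers and gentle algebras -/

/-- A quiver with vertices `V` and arrows `A`, together with a set of quadratic monomial relations:
`rel b a` says that the path `b a` (first `a`, then `b`) is one of the generators of the ideal. -/
structure BoundQuiver (V A : Type*) where
  src : A → V
  tgt : A → V
  rel : A → A → Prop
  rel_comp : ∀ b a, rel b a → src b = tgt a

/-- The list `[a₁, …, aᵣ]` is a nontrivial path `aᵣ ⋯ a₁` in the bound quiver: consecutive arrows
compose and no two consecutive arrows form a relation. -/
def BoundQuiver.IsPath {V A : Type*} (Q : BoundQuiver V A) (p : List A) : Prop :=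
  p ≠ [] ∧ p.IsChain (fun a b => Q.src b = Q.tgt a ∧ ¬ Q.rel b a)

/-- Gentleness of a bound quiver. The last condition says that the ideal is admissible. -/
structure BoundQuiver.IsGentle {V A : Type*} (Q : BoundQuiver V A) : Prop where
  out_le : ∀ x, {a | Q.src a = x}.encard ≤ 2
  in_le : ∀ x, {a | Q.tgt a = x}.encard ≤ 2
  post_nonrel : ∀ a, {b | Q.src b = Q.tgt a ∧ ¬ Q.rel b a}.Subsingleton
  pre_nonrel : ∀ b, {a | Q.src b = Q.tgt a ∧ ¬ Q.rel b a}.Subsingleton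
  post_rel : ∀ a, {b | Q.rel b a}.Subsingleton
  pre_rel : ∀ b, {a | Q.rel b a}.Subsingleton
  admissible : ∃ N : ℕ, ∀ p : List A, Q.IsPath p → p.length ≤ N

/-- The defining relations of the algebra `kQ/I`, on generators the trivial paths (`Sum.inl`) and
the arrows (`Sum.inr`). Products are composed from right to left. -/
inductive AlgRel (k : Type*) [Field k] {V A : Type*} [Fintype V] (Q : BoundQuiver V A) :
    FreeAlgebra k (V ⊕ A) → FreeAlgebra k (V ⊕ A) → Prop
  | idem (x : V) : AlgRel k Q
      (FreeAlgebra.ι k (Sum.inl x) * FreeAlgebra.ι k (Sum.inl x)) (FreeAlgebra.ι k (Sum.inl x))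
  | orth (x y : V) (h : x ≠ y) : AlgRel k Q
      (FreeAlgebra.ι k (Sum.inl x) * FreeAlgebra.ι k (Sum.inl y)) 0
  | one : AlgRel k Q (∑ x : V, FreeAlgebra.ι k (Sum.inl x)) 1
  | tgt (a : A) : AlgRel k Q
      (FreeAlgebra.ι k (Sum.inl (Q.tgt a)) * FreeAlgebra.ι k (Sum.inr a))
      (FreeAlgebra.ι k (Sum.inr a))
  | src (a : A) : AlgRel k Q
      (FreeAlgebra.ι k (Sum.inr a) * FreeAlgebra.ι k (Sum.inl (Q.src a)))
      (FreeAlgebra.ι k (Sum.inr a))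
  | rel (b a : A) (h : Q.rel b a) : AlgRel k Q
      (FreeAlgebra.ι k (Sum.inr b) * FreeAlgebra.ι k (Sum.inr a)) 0

/-- The algebra `Λ = kQ/I`. -/
abbrev Alg (k : Type*) [Field k] {V A : Type*} [Fintype V] (Q : BoundQuiver V A) :=
  RingQuot (AlgRel k Q)

section Complexes

variable (k : Type*) [Field k] {V A : Type*} [Fintype V] (Q : BoundQuiver V A)

/-- The idempotent `e_x` of `Λ`. -/
def idem (x : V) : Alg k Q := RingQuot.mkAlgHom k (AlgRel k Q) (FreeAlgebra.ι k (Sum.inl x))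

/-- The class of an arrow in `Λ`. -/
def arr (a : A) : Alg k Q := RingQuot.mkAlgHom k (AlgRel k Q) (FreeAlgebra.ι k (Sum.inr a))

/-- The class in `Λ` of the path `aᵣ ⋯ a₁` given by the nonempty list `[a₁, …, aᵣ]`. -/
def pathElt (p : List A) : Alg k Q := (p.map (arr k Q)).reverse.prod

theorem arr_mul_idem (a : A) : arr k Q a * idem k Q (Q.src a) = arr k Q a := by
  unfold arr idem
  rw [← map_mul]
  exact RingQuot.mkAlgHom_rel k (AlgRel.src a)

theorem arr_mul_arr (b a : A) (h : Q.rel b a) : arr k Q b * arr k Q a = 0 := by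
  unfold arr
  rw [← map_mul, ← map_zero (RingQuot.mkAlgHom k (AlgRel k Q))]
  exact RingQuot.mkAlgHom_rel k (AlgRel.rel b a h)

theorem pathElt_cons (a : A) (p : List A) : pathElt k Q (a :: p) = pathElt k Q p * arr k Q a := by
  simp [pathElt]

theorem pathElt_concat (p : List A) (a : A) :
    pathElt k Q (p ++ [a]) = arr k Q a * pathElt k Q p := by
  simp [pathElt]

/-- The indecomposable projective left module `P(x) = Λ e_x`. -/
abbrev proj (x : V) : Submodule (Alg k Q) (Alg k Q) := Ideal.span {idem k Q x}

/-- Right multiplication by `u e_y`, as a map `P(x) → P(y)`. -/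
def rmul (x y : V) (u : Alg k Q) : proj k Q x →ₗ[Alg k Q] proj k Q y where
  toFun m := ⟨m.1 * (u * idem k Q y), by
    rw [← mul_assoc]
    exact Ideal.mul_mem_left _ _ (Ideal.subset_span rfl)⟩
  map_add' m n := Subtype.ext (add_mul m.1 n.1 (u * idem k Q y))
  map_smul' r m := Subtype.ext (mul_assoc r m.1 (u * idem k Q y))

/-- The degree `d` part of a graded sum of indecomposable projectives: the direct sum of the
`P(x_a)` over the indices `a` of degree `d`. -/
abbrev Part {ι : Type} (vert : ι → V) (deg : ι → ℤ) (d : ℤ) : Type _ :=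
  (a : {a : ι // deg a = d}) → proj k Q (vert a.1)

/-- The map between two such direct sums with the matrix `F`: its component `P(x_a) → P(y_b)` is
right multiplication by `F a b`. -/
def matHom {ι κ : Type} [Fintype ι] {vert : ι → V} {deg : ι → ℤ} {vert' : κ → V} {deg' : κ → ℤ}
    (F : ι → κ → Alg k Q) (d d' : ℤ) :
    Part k Q vert deg d →ₗ[Alg k Q] Part k Q vert' deg' d' :=
  LinearMap.pi fun b => ∑ a : {a : ι // deg a = d},
    (rmul k Q (vert a.1) (vert' b.1) (F a.1 b.1)).comp (LinearMap.proj a)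

/-- The complex of projectives with differential given by a matrix `D`. -/
def matComplex {ι : Type} [Fintype ι] (vert : ι → V) (deg : ι → ℤ) (D : ι → ι → Alg k Q)
    (hdeg : ∀ a b, deg a + 1 ≠ deg b → D a b = 0)
    (hsq : ∀ a b c, D a b * idem k Q (vert b) * D b c = 0) :
    CochainComplex (ModuleCat (Alg k Q)) ℤ where
  X d := ModuleCat.of (Alg k Q) (Part k Q vert deg d)
  d i j := ModuleCat.ofHom (matHom k Q D i j)
  shape i j hij := by
    refine ModuleCat.hom_ext (LinearMap.ext fun m => funext fun b => Subtype.ext ?_)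
    have h0 : ∀ a : {a : ι // deg a = i}, D a.1 b.1 = 0 := fun a =>
      hdeg _ _ (by rw [a.2, b.2]; exact hij)
    simp [matHom, rmul, h0]
    rfl
  d_comp_d' i j l _ _ := by
    refine ModuleCat.hom_ext (LinearMap.ext fun m => funext fun c => Subtype.ext ?_)
    have h0 : ∀ (a : {a : ι // deg a = i}) (b : {a : ι // deg a = j}),
        D a.1 b.1 * (idem k Q (vert b.1) * (D b.1 c.1 * idem k Q (vert c.1))) = 0 := fun a b => by
      rw [← mul_assoc, ← mul_assoc, hsq, zero_mul]
    simp [matHom, rmul, Finset.sum_mul, mul_assoc, h0]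
    rfl

end Complexes

/-! ### Homotopy letters and homotopy bands -/

/-- A homotopy letter: a nontrivial path `p` in the bound quiver, either direct (the letter is `p`)
or inverse (the letter is the formal inverse of `p`). -/
@[ext]
structure Letter {V A : Type*} (Q : BoundQuiver V A) where
  path : List A
  isPath : Q.IsPath path
  direct : Bool

namespace Letter

variable {V A : Type*} {Q : BoundQuiver V A}

/-- The first arrow of the underlying path. -/
def first (w : Letter Q) : A := w.path.head w.isPath.1

/-- The last arrow of the underlying path. -/
def last (w : Letter Q) : A := w.path.getLast w.isPath.1

/-- The vertex at which the letter starts. -/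
def source (w : Letter Q) : V := if w.direct then Q.src w.first else Q.tgt w.last

/-- The vertex at which the letter ends. -/
def target (w : Letter Q) : V := if w.direct then Q.tgt w.last else Q.src w.first

/-- The inverse letter. -/
def inv (w : Letter Q) : Letter Q := { w with direct := !w.direct }

/-- `w' w` is a homotopy string with letter partition `w', w` (read from right to left): the letters
compose; two direct or two inverse letters are separated by a relation; a direct and an inverse
letter do not cancel. -/
def Composable (w w' : Letter Q) : Prop :=
  w.target = w'.source ∧
    match w.direct, w'.direct with
    | true, true => Q.rel w'.first w.last
    | false, false => Q.rel w.first w'.last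
    | true, false => w.last ≠ w'.last
    | false, true => w.first ≠ w'.first

end Letter

/-- A (graded) homotopy band: a cyclic word `σ_{n-1} ⋯ σ_1 σ_0` of homotopy letters, in which the
letter `i` goes from the vertex number `i` to the vertex number `i + 1` (indices modulo `n`),
together with the cohomological degrees of its vertices, which is not a proper power. A direct letter
`p : x_i → x_{i+1}` stands for a component `P(x_{i+1}) → P(x_i)` of the differential, an inverse
letter for a component `P(x_i) → P(x_{i+1})`. -/
structure HomotopyBand {V A : Type*} (Q : BoundQuiver V A) where
  len : ℕ
  neZero : NeZero len
  letter : ZMod len → Letter Q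
  composable : ∀ i, (letter i).Composable (letter (i + 1))
  deg : ZMod len → ℤ
  deg_letter : ∀ i, deg i = deg (i + 1) + (if (letter i).direct then 1 else -1)
  primitive : ∀ d : ℕ, d ∣ len → d < len → ∃ i, letter (i + d) ≠ letter i

attribute [instance] HomotopyBand.neZero

namespace HomotopyBand

variable {V A : Type*} {Q : BoundQuiver V A}

/-- The vertex number `i` of the band. -/
def vert (σ : HomotopyBand Q) (i : ZMod σ.len) : V := (σ.letter i).source

/-- The index at which the component of the differential given by the letter `i` starts. -/
def arrowSrc (σ : HomotopyBand Q) (i : ZMod σ.len) : ZMod σ.len :=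
  if (σ.letter i).direct then i + 1 else i

/-- The index at which the component of the differential given by the letter `i` ends. -/
def arrowTgt (σ : HomotopyBand Q) (i : ZMod σ.len) : ZMod σ.len :=
  if (σ.letter i).direct then i else i + 1

/-- The coefficient of the letter `i`, when the scalar `lam` is placed on the letter `i₀`. -/
def coef {k : Type*} [Field k] (σ : HomotopyBand Q) (i₀ : ZMod σ.len) (lam : kˣ)
    (i : ZMod σ.len) : k :=
  if i = i₀ then (lam : k) else 1

theorem arrow_deg (σ : HomotopyBand Q) (i : ZMod σ.len) :
    σ.deg (σ.arrowSrc i) + 1 = σ.deg (σ.arrowTgt i) := by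
  have h := σ.deg_letter i
  unfold arrowSrc arrowTgt
  split_ifs at h ⊢ <;> omega

/-- The matrix of the differential of the band complex. -/
def diffMatrix {k : Type*} [Field k] [Fintype V] (σ : HomotopyBand Q) (i₀ : ZMod σ.len) (lam : kˣ)
    (a b : ZMod σ.len) : Alg k Q :=
  ∑ i : ZMod σ.len, if σ.arrowSrc i = a ∧ σ.arrowTgt i = b then
    σ.coef i₀ lam i • pathElt k Q (σ.letter i).path else 0

theorem letter_mul_letter (k : Type*) [Field k] [Fintype V] (w w' : Letter Q)
    (h : Q.rel w'.first w.last) :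
    pathElt k Q w'.path * idem k Q (Q.src w'.first) * pathElt k Q w.path = 0 := by
  have e1 : w'.path = w'.first :: w'.path.tail := (List.cons_head_tail w'.isPath.1).symm
  have e2 : w.path = w.path.dropLast ++ [w.last] := (List.dropLast_append_getLast w.isPath.1).symm
  rw [e1, e2, pathElt_cons, pathElt_concat, mul_assoc, mul_assoc, ← mul_assoc (arr k Q w'.first),
    arr_mul_idem, ← mul_assoc (arr k Q w'.first), arr_mul_arr k Q _ _ h, zero_mul, mul_zero]

theorem arrow_mul_arrow (k : Type*) [Field k] [Fintype V] (σ : HomotopyBand Q) (i j : ZMod σ.len)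
    (h : σ.arrowTgt i = σ.arrowSrc j) :
    pathElt k Q (σ.letter i).path * idem k Q (σ.vert (σ.arrowTgt i)) *
      pathElt k Q (σ.letter j).path = 0 := by
  have key : ∀ i j : ZMod σ.len, i + 1 = j →
      (((σ.letter i).direct = true → (σ.letter j).direct = true →
        Q.rel (σ.letter j).first (σ.letter i).last) ∧
      ((σ.letter i).direct = false → (σ.letter j).direct = false →
        Q.rel (σ.letter i).first (σ.letter j).last)) := by
    rintro i j rfl
    have hc := (σ.composable i).2
    constructor <;> intro h1 h2 <;> simpa [h1, h2] using hc
  unfold arrowTgt arrowSrc at h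
  unfold arrowTgt
  cases hi : (σ.letter i).direct <;> cases hj : (σ.letter j).direct <;>
    simp only [hi, hj, if_true, if_false, Bool.false_eq_true, add_left_inj] at h ⊢
  · have hr := (key i j h).2 hi hj
    have hv : σ.vert (i + 1) = Q.src (σ.letter i).first := by
      have := (σ.composable i).1
      unfold vert
      rw [← this]
      simp [Letter.target, hi]
    rw [hv]
    exact letter_mul_letter k _ _ hr
  · subst h
    rw [hi] at hj
    exact absurd hj (by decide)
  · subst h
    rw [hi] at hj
    exact absurd hj (by decide)
  · have hr := (key j i h.symm).1 hj hi
    have hv : σ.vert i = Q.src (σ.letter i).first := by simp [vert, Letter.source, hi]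
    rw [hv]
    exact letter_mul_letter k _ _ hr

/-- The band complex `B_{σ,λ}`, with the scalar `λ` placed on the letter `i₀`, as a complex of
projective left `Λ`-modules. -/
noncomputable def complex {k : Type*} [Field k] [Fintype V] (σ : HomotopyBand Q)
    (i₀ : ZMod σ.len) (lam : kˣ) : CochainComplex (ModuleCat (Alg k Q)) ℤ :=
  matComplex k Q σ.vert σ.deg (σ.diffMatrix i₀ lam)
    (by
      intro a b hab
      refine Finset.sum_eq_zero fun i _ => if_neg ?_
      rintro ⟨rfl, rfl⟩
      exact hab (σ.arrow_deg i))
    (by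
      intro a b c
      unfold diffMatrix
      rw [Finset.sum_mul, Finset.sum_mul]
      refine Finset.sum_eq_zero fun i _ => ?_
      rw [Finset.mul_sum]
      refine Finset.sum_eq_zero fun j _ => ?_
      split_ifs with h1 h2 h2
      · obtain ⟨-, rfl⟩ := h1
        have := σ.arrow_mul_arrow k i j h2.1.symm
        rw [smul_mul_assoc, smul_mul_assoc, mul_smul_comm, this, smul_zero, smul_zero]
      all_goals simp)

end HomotopyBand

/-! ### Unfolded diagrams, graph maps and quasi-graph maps -/

/-- An unfolded diagram: a two-sided infinite word of homotopy letters, the letter `i` going from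
position `i` to position `i + 1`, with coefficients on the letters and cohomological degrees at the
positions. The position `i` is a copy of the summand `pos i` of the folded complex, whose summands are
indexed by `ι`. -/
structure Unfolded (k : Type*) {V A : Type*} (Q : BoundQuiver V A) (ι : Type) where
  pos : ℤ → ι
  deg : ℤ → ℤ
  letter : ℤ → Letter Q
  coef : ℤ → k

/-- The unfolded diagram of `B_{σ,λ}`, on the word `^∞σ^∞`. It is read in the direction of `σ`
from the vertex `c` on if `rev = false`, and in the opposite direction (so that all the letters are
inverted) if `rev = true`. -/
def HomotopyBand.unfold {k : Type*} [Field k] {V A : Type*} {Q : BoundQuiver V A}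
    (σ : HomotopyBand Q) (i₀ : ZMod σ.len) (lam : kˣ) (rev : Bool) (c : ℤ) :
    Unfolded k Q (ZMod σ.len) :=
  match rev with
  | false =>
    { pos := fun i => ((c + i : ℤ) : ZMod σ.len)
      deg := fun i => σ.deg ((c + i : ℤ) : ZMod σ.len)
      letter := fun i => σ.letter ((c + i : ℤ) : ZMod σ.len)
      coef := fun i => σ.coef i₀ lam ((c + i : ℤ) : ZMod σ.len) }
  | true =>
    { pos := fun i => ((c - i : ℤ) : ZMod σ.len)
      deg := fun i => σ.deg ((c - i : ℤ) : ZMod σ.len)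
      letter := fun i => (σ.letter ((c - i - 1 : ℤ) : ZMod σ.len)).inv
      coef := fun i => σ.coef i₀ lam ((c - i - 1 : ℤ) : ZMod σ.len) }

/-- The unfolded diagram of `Σ⁻¹ B`: degrees go up by one and the differential changes sign. -/
def Unfolded.desuspend {k : Type*} [Field k] {V A : Type*} {Q : BoundQuiver V A} {ι : Type}
    (D : Unfolded k Q ι) : Unfolded k Q ι :=
  { D with
    deg := fun i => D.deg i + 1
    coef := fun i => - D.coef i }

section Maps

variable {k : Type*} [Field k] {V A : Type*} {Q : BoundQuiver V A} {ι κ : Type}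

/-- The positions in the nonempty interval `J` form an overlap of two aligned unfolded diagrams: a
maximal common homotopy substring, placed in the same cohomological degrees. A single position is a
trivial overlap; `J` may be infinite to the left or to the right. -/
structure IsOverlap (D : Unfolded k Q ι) (E : Unfolded k Q κ) (J : Set ℤ) : Prop where
  nonempty : J.Nonempty
  ordConnected : J.OrdConnected
  source_eq : ∀ i ∈ J, (D.letter i).source = (E.letter i).source
  deg_eq : ∀ i ∈ J, D.deg i = E.deg i
  letter_eq : ∀ i, i ∈ J → i + 1 ∈ J → D.letter i = E.letter i
  max_right : ∀ i, i ∈ J → i + 1 ∉ J → D.letter i ≠ E.letter i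
  max_left : ∀ i, i ∉ J → i + 1 ∈ J → D.letter i ≠ E.letter i

/-- `S` is the family of scalars of the vertical isomorphisms over the overlap `J`: the position
`i ∈ J` of the first diagram is mapped to the position `i` of the second one by a nonzero multiple of
the identity. The scalar depends only on the two summands of the folded complexes (all copies of one
summand are identified), and there are no further ones. -/
structure IsVertical (D : Unfolded k Q ι) (E : Unfolded k Q κ) (J : Set ℤ) (S : ι → κ → k) :
    Prop where
  ne_zero : ∀ i ∈ J, S (D.pos i) (E.pos i) ≠ 0
  support : ∀ a b, S a b ≠ 0 → ∃ i ∈ J, D.pos i = a ∧ E.pos i = b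

/-- The endpoint condition for graph maps. Here `w` and `w'` are the letters of the two diagrams
which follow the overlap at one of its ends, read away from the overlap, and `u` is the component
next to the overlap: either both letters have the same orientation and there is a nontrivial path
completing a commutative square (up to scalars), or the component of the first differential points
away from the overlap, that of the second one points into it, and `u = 0`. A letter read away from the
overlap gives a component pointing away from the overlap exactly when it is inverse. -/
def GraphEnd [Fintype V] (w w' : Letter Q) (u : Alg k Q) : Prop :=
  (w.direct = false ∧ w'.direct = true ∧ u = 0) ∨
  (∃ (g : List A) (t : k), g ≠ [] ∧ t ≠ 0 ∧ u = t • pathElt k Q g ∧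
    ((w.direct = false ∧ w'.direct = false ∧ w'.path = g ++ w.path) ∨
     (w.direct = true ∧ w'.direct = true ∧ w.path = w'.path ++ g)))

/-- The endpoint condition for quasi-graph maps, with the letters read away from the overlap. -/
def QuasiGraphEnd (w w' : Letter Q) : Prop :=
  (w.direct = true ∧ w'.direct = false) ∨
  (∃ g : List A, g ≠ [] ∧
    ((w.direct = false ∧ w'.direct = false ∧ w.path = g ++ w'.path) ∨
     (w.direct = true ∧ w'.direct = true ∧ w'.path = w.path ++ g)))

open Classical in
/-- The matrix with the single entry `u` in the place `(a, b)`. -/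
noncomputable def single [Fintype V] (a : ι) (b : κ) (u : Alg k Q) (a' : ι) (b' : κ) : Alg k Q :=
  if a' = a ∧ b' = b then u else 0

/-- `L` is the component of a graph map at the left end of the overlap (none if there is no end). -/
def IsLeftEnd [Fintype V] (D : Unfolded k Q ι) (E : Unfolded k Q κ) (J : Set ℤ)
    (L : ι → κ → Alg k Q) : Prop :=
  (∀ i, i ∉ J → i + 1 ∈ J → ∃ u, L = single (D.pos i) (E.pos i) u ∧
    GraphEnd (D.letter i).inv (E.letter i).inv u) ∧
  ((∀ i, i + 1 ∈ J → i ∈ J) → L = 0)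

/-- `R` is the component of a graph map at the right end of the overlap (none if there is no end). -/
def IsRightEnd [Fintype V] (D : Unfolded k Q ι) (E : Unfolded k Q κ) (J : Set ℤ)
    (R : ι → κ → Alg k Q) : Prop :=
  (∀ i, i ∈ J → i + 1 ∉ J → ∃ u, R = single (D.pos (i + 1)) (E.pos (i + 1)) u ∧
    GraphEnd (D.letter i) (E.letter i) u) ∧
  ((∀ i, i ∈ J → i + 1 ∈ J) → R = 0)

/-- The quasi-graph map with vertical scalars `S` determined by the overlap `J` of two aligned
unfolded diagrams: over the overlap all the squares commute (with the coefficients of the two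
diagrams), and the endpoint conditions for quasi-graph maps hold. It is a diagram and need not be a
chain map. -/
structure IsQuasiGraphMap (D : Unfolded k Q ι) (E : Unfolded k Q κ) (J : Set ℤ)
    (S : ι → κ → k) : Prop where
  overlap : IsOverlap D E J
  vertical : IsVertical D E J S
  square : ∀ i, i ∈ J → i + 1 ∈ J →
    if (D.letter i).direct then
      D.coef i * S (D.pos i) (E.pos i) = S (D.pos (i + 1)) (E.pos (i + 1)) * E.coef i
    else
      D.coef i * S (D.pos (i + 1)) (E.pos (i + 1)) = S (D.pos i) (E.pos i) * E.coef i
  left : ∀ i, i ∉ J → i + 1 ∈ J → QuasiGraphEnd (D.letter i).inv (E.letter i).inv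
  right : ∀ i, i ∈ J → i + 1 ∉ J → QuasiGraphEnd (D.letter i) (E.letter i)

end Maps

/-- The chain map `f : B_{σ,λ} → B_{τ,μ}` is a graph map determined by the overlap `J` of the unfolded
diagram of `σ` with that of `τ`, the latter being read from `c` on in the direction given by `rev`: its
components are multiples of identities over the overlap, and the components at the two ends of
the overlap that the endpoint conditions prescribe. -/
def IsGraphMap {k : Type*} [Field k] {V A : Type*} [Fintype V] {Q : BoundQuiver V A}
    {σ τ : HomotopyBand Q} {i₀ : ZMod σ.len} {j₀ : ZMod τ.len} {lam mu : kˣ}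
    (f : σ.complex i₀ lam ⟶ τ.complex j₀ mu) (rev : Bool) (c : ℤ) (J : Set ℤ) : Prop :=
  IsOverlap (σ.unfold i₀ lam false 0) (τ.unfold j₀ mu rev c) J ∧
  ∃ (S : ZMod σ.len → ZMod τ.len → k) (L R : ZMod σ.len → ZMod τ.len → Alg k Q),
    IsVertical (σ.unfold i₀ lam false 0) (τ.unfold j₀ mu rev c) J S ∧
    IsLeftEnd (σ.unfold i₀ lam false 0) (τ.unfold j₀ mu rev c) J L ∧
    IsRightEnd (σ.unfold i₀ lam false 0) (τ.unfold j₀ mu rev c) J R ∧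
    ∀ d : ℤ, f.f d = ModuleCat.ofHom
      (matHom k Q (vert := σ.vert) (deg := σ.deg) (vert' := τ.vert) (deg' := τ.deg)
        (fun a b => S a b • idem k Q (σ.vert a) + L a b + R a b) d d)

end Gentle

/-! Both unfolded words are periodic, so agreement along an infinite interval forces agreement
everywhere, and maximality then makes the overlap all of `ℤ` (`eq_univ_and_letter_eq`). The greatest
common divisor of the two lengths is a period of the common word, so primitivity makes the lengths
equal, and the cyclic words are matched vertex by vertex and letter by letter (`exists_alignment`).
The overlap has no ends, so only the vertical scalars remain: a monomial matrix with nonzero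
entries, which is invertible in every degree. A graph map is thus already an isomorphism of
complexes. For a quasi-graph map the commuting squares say precisely that the same kind of matrix is
a chain map to the desuspension (`Alignment.complexIso`).

The parameters are compared by holonomy (`Alignment.scalar_eq`). Each letter gives a relation
between the vertical scalars at its two ends. Multiplying these relations once around the band
cancels the vertical scalars and leaves `lam = mu` or `lam * mu = 1`, according to direction. The
sign of the desuspension does not survive, because it is absorbed by the factor `(-1) ^ deg` at each
vertex.

For a quasi-graph map these relations are given. For a graph map they have to be extracted from an
equation of matrices over `Λ`, which requires reading off the coefficient of a path. This is done by
letting `Λ` act on a vector space spanned by paths (`pathCoef_pathElt`,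
`HomotopyBand.pathCoef_diffMatrix`, `Alignment.coef_eq_of_comm`). -/

namespace Gentle

/-! ### Coefficients of paths in `Λ` -/

section PathModule

variable {k : Type*} [Field k] {V A : Type*} {Q : BoundQuiver V A}

/-- The end of the path which starts at `p.1` and runs through the arrows of `p.2`, the last arrow
being the head of the list. -/
def pathEnd (Q : BoundQuiver V A) : V × List A → V
  | (x, []) => x
  | (_, a :: _) => Q.tgt a

/-- The arrow `a` prolongs the path `p` to a nonzero path. -/
def Prolongs (Q : BoundQuiver V A) (a : A) (p : V × List A) : Prop :=
  Q.src a = pathEnd Q p ∧ ∀ b ∈ p.2.head?, ¬ Q.rel a b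

open Classical in
/-- The action of an arrow on the vector space spanned by the paths. -/
noncomputable def arrAct (k : Type*) [Field k] (Q : BoundQuiver V A) (a : A) :
    Module.End k (V × List A →₀ k) :=
  Finsupp.linearCombination k fun p =>
    if Prolongs Q a p then Finsupp.single (p.1, a :: p.2) 1 else 0

open Classical in
/-- The action of a trivial path on the vector space spanned by the paths. -/
noncomputable def idemAct (k : Type*) [Field k] (Q : BoundQuiver V A) (x : V) :
    Module.End k (V × List A →₀ k) :=
  Finsupp.linearCombination k fun p => if pathEnd Q p = x then Finsupp.single p 1 else 0

open Classical in
theorem arrAct_single (a : A) (p : V × List A) :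
    arrAct k Q a (Finsupp.single p 1) =
      if Prolongs Q a p then Finsupp.single (p.1, a :: p.2) 1 else 0 := by
  simp [arrAct]

open Classical in
theorem idemAct_single (x : V) (p : V × List A) :
    idemAct k Q x (Finsupp.single p 1) = if pathEnd Q p = x then Finsupp.single p 1 else 0 := by
  simp [idemAct]

theorem pathModule_hom_ext {f g : Module.End k (V × List A →₀ k)}
    (h : ∀ p, f (Finsupp.single p 1) = g (Finsupp.single p 1)) : f = g :=
  Finsupp.lhom_ext' fun p => LinearMap.ext_ring (h p)

variable [Fintype V]

/-- The action of the free algebra on the vector space spanned by the paths. -/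
noncomputable def freeAct (k : Type*) [Field k] (Q : BoundQuiver V A) :
    FreeAlgebra k (V ⊕ A) →ₐ[k] Module.End k (V × List A →₀ k) :=
  FreeAlgebra.lift k (Sum.elim (idemAct k Q) (arrAct k Q))

/-- Each relation is checked on basis vectors. The basis also contains lists that are not paths;
this does no harm, since the action only looks at the end vertex and the last arrow. A relation `b
a` acts by zero because after prolongation by `a` the last arrow is `a`, which blocks `b`. -/
theorem freeAct_rel ⦃u v : FreeAlgebra k (V ⊕ A)⦄ (h : AlgRel k Q u v) :
    freeAct k Q u = freeAct k Q v := by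
  classical
  cases h with
  | idem x =>
    refine pathModule_hom_ext fun p => ?_
    simp only [freeAct, map_mul, FreeAlgebra.lift_ι_apply, Sum.elim_inl, Module.End.mul_apply,
      idemAct_single]
    split_ifs with h <;> simp [idemAct_single, h]
  | orth x y hxy =>
    refine pathModule_hom_ext fun p => ?_
    simp only [freeAct, map_mul, FreeAlgebra.lift_ι_apply, Sum.elim_inl, Module.End.mul_apply,
      idemAct_single, map_zero]
    split_ifs with h
    · simp [idemAct_single, h, hxy.symm]
    · simp
  | one =>
    refine pathModule_hom_ext fun p => ?_
    simp [freeAct, LinearMap.sum_apply, idemAct_single]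
  | tgt a =>
    refine pathModule_hom_ext fun p => ?_
    simp only [freeAct, map_mul, FreeAlgebra.lift_ι_apply, Sum.elim_inl, Sum.elim_inr,
      Module.End.mul_apply, arrAct_single]
    split_ifs with h
    · simp [idemAct_single, pathEnd]
    · simp
  | src a =>
    refine pathModule_hom_ext fun p => ?_
    simp only [freeAct, map_mul, FreeAlgebra.lift_ι_apply, Sum.elim_inl, Sum.elim_inr,
      Module.End.mul_apply, idemAct_single]
    split_ifs with h
    · rfl
    · rw [arrAct_single, if_neg fun h' => h h'.1.symm, map_zero]
  | rel b a hba =>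
    refine pathModule_hom_ext fun p => ?_
    simp only [freeAct, map_mul, FreeAlgebra.lift_ι_apply, Sum.elim_inr,
      Module.End.mul_apply, arrAct_single, map_zero]
    split_ifs with h
    · rw [arrAct_single, if_neg fun h' => h'.2 a rfl hba, LinearMap.zero_apply]
    · simp

/-- The action of `Λ` on the vector space spanned by the paths. -/
noncomputable def pathAct (k : Type*) [Field k] (Q : BoundQuiver V A) :
    Alg k Q →ₐ[k] Module.End k (V × List A →₀ k) :=
  RingQuot.liftAlgHom k ⟨freeAct k Q, freeAct_rel⟩

theorem pathAct_arr (a : A) : pathAct k Q (arr k Q a) = arrAct k Q a := by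
  simp [pathAct, arr, RingQuot.liftAlgHom_mkAlgHom_apply, freeAct]

/-- Applied to the trivial path at `x`, the arrows stack up one at a time, and the chain condition
says that no step is blocked. A path can therefore be recovered from the action of its class. -/
theorem pathAct_word (x : V) (r : List A)
    (hr : r.IsChain (fun b a => Q.src b = Q.tgt a ∧ ¬ Q.rel b a))
    (hx : ∀ a ∈ r.getLast?, Q.src a = x) :
    pathAct k Q (r.map (arr k Q)).prod (Finsupp.single (x, []) 1) = Finsupp.single (x, r) 1 := by
  classical
  induction r with
  | nil => simp
  | cons a r ih =>
    have hr' := hr.tail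
    rw [List.map_cons, List.prod_cons, map_mul, Module.End.mul_apply, pathAct_arr]
    cases r with
    | nil =>
      simp only [List.map_nil, List.prod_nil, map_one, Module.End.one_apply]
      rw [arrAct_single, if_pos ⟨by simpa [pathEnd] using hx, by simp⟩]
    | cons b r =>
      rw [ih hr' (by simpa using hx), arrAct_single, if_pos]
      rw [List.isChain_cons_cons] at hr
      exact ⟨hr.1.1, by simpa using hr.1.2⟩

/-- The coefficient in `u : Λ` of the path `p` starting at `x`. -/
noncomputable def pathCoef (x : V) (p : List A) : Alg k Q →ₗ[k] k :=
  Finsupp.lapply (x, p.reverse) ∘ₗ LinearMap.applyₗ (Finsupp.single (x, []) 1) ∘ₗ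
    (pathAct k Q).toLinearMap

-- Classes of distinct paths with the same start send the trivial path to distinct basis vectors.
-- This is the linear independence in `Λ` that makes the coefficients of a differential well
-- defined.
open Classical in
theorem pathCoef_pathElt (p : List A) {q : List A} (hq : Q.IsPath q) :
    pathCoef (k := k) (Q.src (q.head hq.1)) p (pathElt k Q q) = if q = p then 1 else 0 := by
  have h : pathAct k Q (pathElt k Q q) (Finsupp.single (Q.src (q.head hq.1), []) 1) =
      Finsupp.single (Q.src (q.head hq.1), q.reverse) 1 := by
    unfold pathElt
    rw [← List.map_reverse]
    refine pathAct_word _ _ ?_ ?_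
    · rw [List.isChain_reverse]
      exact hq.2
    · intro a ha
      rw [List.getLast?_reverse, List.head?_eq_some_head hq.1] at ha
      rw [Option.mem_some.1 ha]
  simp [pathCoef, h, Finsupp.single_apply]

theorem idem_mul_arr (a : A) : idem k Q (Q.tgt a) * arr k Q a = arr k Q a := by
  unfold arr idem
  rw [← map_mul]
  exact RingQuot.mkAlgHom_rel k (AlgRel.tgt a)

theorem idem_mul_idem (x : V) : idem k Q x * idem k Q x = idem k Q x := by
  unfold idem
  rw [← map_mul]
  exact RingQuot.mkAlgHom_rel k (AlgRel.idem x)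

theorem pathElt_mul_idem (w : Letter Q) :
    pathElt k Q w.path * idem k Q (Q.src w.first) = pathElt k Q w.path := by
  have e : w.path = w.first :: w.path.tail := (List.cons_head_tail w.isPath.1).symm
  rw [e, pathElt_cons, mul_assoc, arr_mul_idem]

theorem idem_mul_pathElt (w : Letter Q) :
    idem k Q (Q.tgt w.last) * pathElt k Q w.path = pathElt k Q w.path := by
  have e : w.path = w.path.dropLast ++ [w.last] := (List.dropLast_append_getLast w.isPath.1).symm
  rw [e, pathElt_concat, ← mul_assoc, idem_mul_arr]

end PathModule

/-! ### The differential of a band complex -/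

namespace Letter

variable {V A : Type*} {Q : BoundQuiver V A}

@[simp] theorem inv_inv (w : Letter Q) : w.inv.inv = w := by
  ext <;> simp [inv]

@[simp] theorem inv_direct (w : Letter Q) : w.inv.direct = !w.direct := rfl

@[simp] theorem inv_path (w : Letter Q) : w.inv.path = w.path := rfl

theorem inv_source (w : Letter Q) : w.inv.source = w.target := by
  cases h : w.direct <;> simp [source, target, h, first, last]

theorem inv_injective : Function.Injective (inv : Letter Q → Letter Q) :=
  Function.LeftInverse.injective inv_inv

end Letter

namespace HomotopyBand

variable {V A : Type*} {Q : BoundQuiver V A}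

theorem vert_arrowTgt (σ : HomotopyBand Q) (i : ZMod σ.len) :
    σ.vert (σ.arrowTgt i) = Q.src (σ.letter i).first := by
  have hc : σ.vert (i + 1) = (σ.letter i).target := (σ.composable i).1.symm
  cases h : (σ.letter i).direct
  · simp [arrowTgt, h, hc, Letter.target]
  · simp [arrowTgt, h, vert, Letter.source]

theorem vert_arrowSrc (σ : HomotopyBand Q) (i : ZMod σ.len) :
    σ.vert (σ.arrowSrc i) = Q.tgt (σ.letter i).last := by
  have hc : σ.vert (i + 1) = (σ.letter i).target := (σ.composable i).1.symm
  cases h : (σ.letter i).direct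
  · simp [arrowSrc, h, vert, Letter.source]
  · simp [arrowSrc, h, hc, Letter.target]

/-- A component of the differential is determined by its path and its ends. -/
theorem arrow_injective (σ : HomotopyBand Q) {i j : ZMod σ.len}
    (hs : σ.arrowSrc i = σ.arrowSrc j) (ht : σ.arrowTgt i = σ.arrowTgt j)
    (hp : (σ.letter i).path = (σ.letter j).path) : i = j := by
  have hlast : (σ.letter i).last = (σ.letter j).last := by simp only [Letter.last, hp]
  have hfirst : (σ.letter i).first = (σ.letter j).first := by simp only [Letter.first, hp]
  unfold arrowSrc at hs
  unfold arrowTgt at ht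
  cases hi : (σ.letter i).direct <;> cases hj : (σ.letter j).direct <;>
    simp only [hi, hj, if_true, if_false, Bool.false_eq_true] at hs ht
  · exact hs
  -- With opposite orientations and the same ends, `i` and `j` are neighbours in the cyclic word,
  -- and equal paths would make them cancel.
  · have := (σ.composable i).2
    rw [ht] at this
    simp [hi, hj, hfirst] at this
  · have := (σ.composable i).2
    rw [hs] at this
    simp [hi, hj, hlast] at this
  · exact ht

variable {k : Type*} [Field k] [Fintype V]

/-- Lets the idempotents that appear when the differential is tested on a generator of a summand be
dropped. -/
theorem idem_mul_diffMatrix_mul_idem (σ : HomotopyBand Q) (i₀ : ZMod σ.len) (lam : kˣ)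
    (a b : ZMod σ.len) :
    idem k Q (σ.vert a) * σ.diffMatrix i₀ lam a b * idem k Q (σ.vert b) =
      σ.diffMatrix i₀ lam a b := by
  unfold diffMatrix
  rw [Finset.mul_sum, Finset.sum_mul]
  refine Finset.sum_congr rfl fun i _ => ?_
  split_ifs with h
  · obtain ⟨rfl, rfl⟩ := h
    rw [vert_arrowSrc, vert_arrowTgt, mul_smul_comm, smul_mul_assoc, idem_mul_pathElt,
      pathElt_mul_idem]
  · simp

/-- The coefficient of a letter can be read off from the matrix of the differential. -/
theorem pathCoef_diffMatrix (σ : HomotopyBand Q) (i₀ : ZMod σ.len) (lam : kˣ) (i : ZMod σ.len) :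
    pathCoef (k := k) (σ.vert (σ.arrowTgt i)) (σ.letter i).path
      (σ.diffMatrix i₀ lam (σ.arrowSrc i) (σ.arrowTgt i)) = σ.coef i₀ lam i := by
  classical
  unfold diffMatrix
  rw [map_sum, Finset.sum_eq_single i]
  · rw [if_pos ⟨rfl, rfl⟩, map_smul, vert_arrowTgt]
    have := pathCoef_pathElt (k := k) (σ.letter i).path (σ.letter i).isPath
    rw [if_pos rfl] at this
    rw [Letter.first, this, smul_eq_mul, mul_one]
  -- Another letter may join the same two summands, but then its path differs, so it does not
  -- contribute to this coefficient.
  · intro j _ hj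
    split_ifs with h
    · rw [map_smul, ← h.2, vert_arrowTgt]
      have := pathCoef_pathElt (k := k) (σ.letter i).path (σ.letter j).isPath
      rw [if_neg fun hp => hj (σ.arrow_injective h.1 h.2 hp)] at this
      rw [Letter.first, this, smul_zero]
    · exact map_zero _
  · exact fun h => absurd (Finset.mem_univ i) h

end HomotopyBand

end Gentle

namespace Gentle

/-! ### Infinite overlaps -/

/-- Two periodic two-sided infinite words which agree along an infinite interval agree. -/
theorem eq_of_periodic_of_infinite {X : Type*} {u v : ℤ → X} {N : ℤ} (hN : 0 < N)
    (hu : Function.Periodic u N) (hv : Function.Periodic v N) {J : Set ℤ} (hJ : J.Infinite)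
    (hc : J.OrdConnected) (h : ∀ i, i ∈ J → i + 1 ∈ J → u i = v i) : u = v := by
  have key : ∀ i : ℤ, ∃ t : ℤ, i + t * N ∈ J ∧ i + t * N + 1 ∈ J := by
    intro i
    obtain ⟨a, ha⟩ := hJ.nonempty
    have hb : ¬ BddAbove J ∨ ¬ BddBelow J := by
      by_contra! hb
      exact hJ (hb.2.finite_of_bddAbove hb.1)
    rcases hb with hb | hb
    -- Since `N ≥ 1`, moving by `|a - i|` periods carries `i` past the point `a` of `J`; `b` lies
    -- beyond both positions needed.
    · obtain ⟨b, hb, hlt⟩ := not_bddAbove_iff.1 hb (i + |a - i| * N + 1)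
      have h1 : a ≤ i + |a - i| * N := by nlinarith [le_abs_self (a - i), abs_nonneg (a - i)]
      exact ⟨|a - i|, hc.out ha hb ⟨h1, by omega⟩, hc.out ha hb ⟨by omega, by omega⟩⟩
    -- One period more than above, so that the successor position also stays below `a`.
    · obtain ⟨b, hb, hlt⟩ := not_bddBelow_iff.1 hb (i + -(|a - i| + 1) * N)
      have h1 : i + -(|a - i| + 1) * N + 1 ≤ a := by
        nlinarith [neg_abs_le (a - i), abs_nonneg (a - i)]
      exact ⟨-(|a - i| + 1), hc.out hb ha ⟨by omega, by omega⟩,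
        hc.out hb ha ⟨by omega, h1⟩⟩
  funext i
  obtain ⟨t, h1, h2⟩ := key i
  rw [← hu.int_mul t i, ← hv.int_mul t i]
  exact h _ h1 h2

theorem eq_univ_of_succ_mem_iff {J : Set ℤ} (hJ : J.Nonempty) (h : ∀ i, i + 1 ∈ J ↔ i ∈ J) :
    J = Set.univ := by
  obtain ⟨a, ha⟩ := hJ
  refine Set.eq_univ_of_forall fun i => ?_
  induction i using Int.inductionOn' (b := a) with
  | zero => exact ha
  | succ i _ hi => exact (h i).2 hi
  | pred i _ hi => exact (h (i - 1)).1 (by simpa using hi)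

section

variable {k : Type*} {V A : Type*} {Q : BoundQuiver V A}

/-- At an end of `J` maximality would demand two different letters. -/
theorem IsOverlap.eq_univ {ι κ : Type} {D : Unfolded k Q ι} {E : Unfolded k Q κ} {J : Set ℤ}
    (h : IsOverlap D E J) (hDE : D.letter = E.letter) : J = Set.univ := by
  refine eq_univ_of_succ_mem_iff h.nonempty fun i => ⟨fun hi => ?_, fun hi => ?_⟩
  · by_contra hn
    exact h.max_left i hn hi (congrFun hDE i)
  · by_contra hn
    exact h.max_right i hi hn (congrFun hDE i)

variable [Field k]

namespace HomotopyBand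

theorem unfold_letter_periodic (σ : HomotopyBand Q) (i₀ : ZMod σ.len) (lam : kˣ) (rev : Bool)
    (c : ℤ) : Function.Periodic (σ.unfold i₀ lam rev c).letter (σ.len : ℤ) := by
  intro i
  cases rev <;> simp [unfold]

/-- The length of a band is the least period of its unfolded word. -/
theorem eq_len_of_periodic (σ : HomotopyBand Q) (i₀ : ZMod σ.len) (lam : kˣ) (rev : Bool) (c : ℤ)
    {d : ℕ} (hd : d ∣ σ.len)
    (h : Function.Periodic (σ.unfold i₀ lam rev c).letter (d : ℤ)) : d = σ.len := by
  by_contra hne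
  obtain ⟨j, hj⟩ := σ.primitive d hd
    (lt_of_le_of_ne (Nat.le_of_dvd (Nat.pos_of_ne_zero σ.neZero.out) hd) hne)
  obtain ⟨j, rfl⟩ := ZMod.intCast_surjective j
  apply hj
  cases rev with
  | false =>
    have := h (j - c)
    simp only [unfold, Int.cast_sub, Int.cast_add, Int.cast_natCast] at this
    ring_nf at this
    exact this
  | true =>
    -- Read backwards, this position and the one `d` further carry the inverses of the letters `j +
    -- d` and `j`.
    have := h (c - j - 1 - d)
    have := Letter.inv_injective this
    simp only [Int.cast_sub, Int.cast_add, Int.cast_one, Int.cast_natCast] at this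
    ring_nf at this
    exact this.symm

/-- By Bézout the greatest common divisor of the lengths is a period of the common word; as each
length is the least period among its divisors, both equal it. -/
theorem len_eq_of_unfold_letter_eq {σ τ : HomotopyBand Q} {i₀ : ZMod σ.len} {j₀ : ZMod τ.len}
    {lam mu : kˣ} {rev rev' : Bool} {c c' : ℤ}
    (h : (σ.unfold i₀ lam rev' c').letter = (τ.unfold j₀ mu rev c).letter) :
    σ.len = τ.len := by
  have hσ := σ.unfold_letter_periodic i₀ lam rev' c'
  have hτ := τ.unfold_letter_periodic j₀ mu rev c
  have hg : Function.Periodic (σ.unfold i₀ lam rev' c').letter ((σ.len.gcd τ.len : ℕ) : ℤ) := by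
    rw [Nat.gcd_eq_gcd_ab, mul_comm, mul_comm (τ.len : ℤ)]
    exact (hσ.int_mul _).add_period ((h ▸ hτ).int_mul _)
  exact (σ.eq_len_of_periodic i₀ lam rev' c' (Nat.gcd_dvd_left _ _) hg).symm.trans
    (τ.eq_len_of_periodic j₀ mu rev c (Nat.gcd_dvd_right _ _) (h ▸ hg))

end HomotopyBand

/-- An infinite overlap of the unfolded diagrams of two bands is the whole word. -/
theorem eq_univ_and_letter_eq {σ τ : HomotopyBand Q} {i₀ : ZMod σ.len} {j₀ : ZMod τ.len}
    {lam mu : kˣ} {rev : Bool} {c : ℤ} {J : Set ℤ} (hJ : J.Infinite)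
    {E : Unfolded k Q (ZMod τ.len)} (hE : E.letter = (τ.unfold j₀ mu rev c).letter)
    (h : IsOverlap (σ.unfold i₀ lam false 0) E J) :
    J = Set.univ ∧ (σ.unfold i₀ lam false 0).letter = (τ.unfold j₀ mu rev c).letter := by
  -- The product of the two lengths serves as a common period.
  have hσ := (σ.unfold_letter_periodic i₀ lam false 0).int_mul τ.len
  have hτ := (τ.unfold_letter_periodic j₀ mu rev c).int_mul σ.len
  rw [mul_comm] at hσ
  have hN : (0 : ℤ) < σ.len * τ.len := by
    have := Nat.pos_of_ne_zero σ.neZero.out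
    have := Nat.pos_of_ne_zero τ.neZero.out
    positivity
  have hl := eq_of_periodic_of_infinite hN hσ hτ hJ h.ordConnected fun i h1 h2 => by
    rw [h.letter_eq i h1 h2, hE]
  exact ⟨h.eq_univ (hl.trans hE.symm), hl⟩

/-! ### Alignments of bands -/

/-- An identification of the cyclic words of two bands, read in the same direction if `rev = false`
and in opposite directions if `rev = true`, up to a shift of degrees by `s`. -/
structure Alignment (σ τ : HomotopyBand Q) (rev : Bool) (s : ℤ) where
  vertex : ZMod σ.len ≃ ZMod τ.len
  edge : ZMod σ.len ≃ ZMod τ.len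
  path_eq : ∀ i, (τ.letter (edge i)).path = (σ.letter i).path
  direct_eq : ∀ i, (τ.letter (edge i)).direct = xor rev (σ.letter i).direct
  arrowSrc_eq : ∀ i, τ.arrowSrc (edge i) = vertex (σ.arrowSrc i)
  arrowTgt_eq : ∀ i, τ.arrowTgt (edge i) = vertex (σ.arrowTgt i)
  vert_eq : ∀ a, τ.vert (vertex a) = σ.vert a
  deg_eq : ∀ a, τ.deg (vertex a) + s = σ.deg a

/-- Bands with the same unfolded word are aligned. -/
theorem exists_alignment {σ τ : HomotopyBand Q} {i₀ : ZMod σ.len} {j₀ : ZMod τ.len}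
    {lam mu : kˣ} {rev : Bool} {c s : ℤ}
    (hl : (σ.unfold i₀ lam false 0).letter = (τ.unfold j₀ mu rev c).letter)
    (hd : ∀ i, (σ.unfold i₀ lam false 0).deg i = (τ.unfold j₀ mu rev c).deg i + s) :
    ∃ φ : Alignment σ τ rev s, ∀ i : ℤ, φ.vertex i = (τ.unfold j₀ mu rev c).pos i ∧
      τ.coef j₀ mu (φ.edge i) = (τ.unfold j₀ mu rev c).coef i := by
  let e := ZMod.ringEquivCongr (HomotopyBand.len_eq_of_unfold_letter_eq hl)
  cases rev with
  | false =>
    have hl' : ∀ a, τ.letter (c + e a) = σ.letter a := by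
      intro a
      obtain ⟨i, rfl⟩ := ZMod.intCast_surjective a
      have := congrFun hl i
      simp only [HomotopyBand.unfold, zero_add, Int.cast_add] at this
      rw [map_intCast, this]
    have hd' : ∀ a, τ.deg (c + e a) + s = σ.deg a := by
      intro a
      obtain ⟨i, rfl⟩ := ZMod.intCast_surjective a
      have := hd i
      simp only [HomotopyBand.unfold, zero_add, Int.cast_add] at this
      rw [map_intCast, this]
    refine ⟨⟨e.toEquiv.trans (Equiv.addLeft (c : ZMod τ.len)),
      e.toEquiv.trans (Equiv.addLeft (c : ZMod τ.len)), fun i => ?_, fun i => ?_, fun i => ?_,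
      fun i => ?_, fun a => ?_, fun a => ?_⟩, fun i => ?_⟩
    · simp [hl']
    · simp [hl']
    · simp only [HomotopyBand.arrowSrc, Equiv.trans_apply, Equiv.coe_addLeft,
        RingEquiv.toEquiv_eq_coe, EquivLike.coe_coe, hl']
      split_ifs <;> simp [add_assoc]
    · simp only [HomotopyBand.arrowTgt, Equiv.trans_apply, Equiv.coe_addLeft,
        RingEquiv.toEquiv_eq_coe, EquivLike.coe_coe, hl']
      split_ifs <;> simp [add_assoc]
    · simp [HomotopyBand.vert, hl']
    · simp [hd']
    · simp [HomotopyBand.unfold]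
  | true =>
    have hl' : ∀ a, τ.letter (c - 1 - e a) = (σ.letter a).inv := by
      intro a
      obtain ⟨i, rfl⟩ := ZMod.intCast_surjective a
      have := congrFun hl i
      simp only [HomotopyBand.unfold, zero_add, Int.cast_sub, Int.cast_one] at this
      rw [map_intCast, this, Letter.inv_inv, sub_right_comm]
    have hd' : ∀ a, τ.deg (c - e a) + s = σ.deg a := by
      intro a
      obtain ⟨i, rfl⟩ := ZMod.intCast_surjective a
      have := hd i
      simp only [HomotopyBand.unfold, zero_add, Int.cast_sub] at this
      rw [map_intCast, this]
    -- Reversal sends vertex `a` to `c - a`. The letter between `a` and `a + 1` goes to the one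
    -- between `c - a - 1` and `c - a`, which is numbered by the smaller end; hence the extra `- 1`
    -- for edges.
    refine ⟨⟨e.toEquiv.trans (Equiv.subLeft (c : ZMod τ.len)),
      e.toEquiv.trans (Equiv.subLeft (c - 1 : ZMod τ.len)), fun i => ?_, fun i => ?_, fun i => ?_,
      fun i => ?_, fun a => ?_, fun a => ?_⟩, fun i => ?_⟩
    · simp [hl']
    · simp [hl']
    · cases h : (σ.letter i).direct <;> simp [HomotopyBand.arrowSrc, hl', h] <;> ring
    · cases h : (σ.letter i).direct <;> simp [HomotopyBand.arrowTgt, hl', h] <;> ring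
    · have := (τ.composable (c - 1 - e a)).1
      rw [hl', ← Letter.inv_source, Letter.inv_inv] at this
      simp only [HomotopyBand.vert, Equiv.trans_apply, RingEquiv.toEquiv_eq_coe,
        EquivLike.coe_coe, Equiv.subLeft_apply]
      rw [this]
      congr 2
      ring
    · simp [hd']
    · simp [HomotopyBand.unfold, sub_right_comm]

/-- The scalars of a chain isomorphism between aligned bands determine the parameters up to
inversion. -/
theorem Alignment.scalar_eq {σ τ : HomotopyBand Q} {rev : Bool} {s : ℤ}
    (φ : Alignment σ τ rev s) {i₀ : ZMod σ.len} (hi₀ : (σ.letter i₀).direct = true)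
    {j₀ : ZMod τ.len} (hj₀ : (τ.letter j₀).direct = true) {lam mu : kˣ}
    {S : ZMod σ.len → k} (hS : ∀ a, S a ≠ 0) {η : k} (hη : η * η = 1)
    (h : ∀ i, σ.coef i₀ lam i * S (σ.arrowTgt i) =
      η * (S (σ.arrowSrc i) * τ.coef j₀ mu (φ.edge i))) :
    (rev = false → lam = mu) ∧ (rev = true → lam = mu⁻¹) := by
  have hη0 : η ≠ 0 := left_ne_zero_of_mul_eq_one hη
  -- Arrows raise the degree by one and `η * η = 1`, so this rescaling removes `η` from every
  -- relation.
  let T : ZMod σ.len → k := fun a => η ^ σ.deg a * S a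
  -- `X` and `Y` sort the coefficients so that every relation, whatever the orientation of its
  -- letter, relates vertex `i` to vertex `i + 1`.
  let X : ZMod σ.len → k := fun i =>
    if (σ.letter i).direct then σ.coef i₀ lam i else τ.coef j₀ mu (φ.edge i)
  let Y : ZMod σ.len → k := fun i =>
    if (σ.letter i).direct then τ.coef j₀ mu (φ.edge i) else σ.coef i₀ lam i
  have hT : ∀ i, X i * T i = Y i * T (i + 1) := by
    intro i
    have h1 := h i
    have h2 := σ.arrow_deg i
    have h3 : σ.coef i₀ lam i * T (σ.arrowTgt i) =
        T (σ.arrowSrc i) * τ.coef j₀ mu (φ.edge i) := by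
      simp only [T]
      rw [← h2, zpow_add₀ hη0, zpow_one]
      linear_combination (η ^ σ.deg (σ.arrowSrc i) * η) * h1 +
        η ^ σ.deg (σ.arrowSrc i) * S (σ.arrowSrc i) * τ.coef j₀ mu (φ.edge i) * hη
    unfold HomotopyBand.arrowSrc HomotopyBand.arrowTgt at h3
    simp only [X, Y]
    split_ifs at h3 ⊢
    · rw [h3, mul_comm]
    · rw [h3, mul_comm]
  -- Going once around the band, the product of the `T (i + 1)` is the product of the `T i`, which
  -- is nonzero and cancels.
  have hprod : (∏ i, X i) = ∏ i, Y i := by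
    have h1 : (∏ i, X i) * ∏ i, T i = (∏ i, Y i) * ∏ i, T i := by
      rw [← Finset.prod_mul_distrib, Finset.prod_congr rfl fun i _ => hT i,
        Finset.prod_mul_distrib]
      exact congrArg _ (Equiv.prod_comp (Equiv.addRight (1 : ZMod σ.len)) T)
    exact mul_right_cancel₀ (Finset.prod_ne_zero_iff.2 fun a _ =>
      mul_ne_zero (zpow_ne_zero _ hη0) (hS a)) h1
  -- The letter carrying `mu` matches a direct letter of `σ` or an inverse one, depending on `rev`;
  -- this decides whether `mu` enters `Y` or `X`.
  have hdir : (σ.letter (φ.edge.symm j₀)).direct = !rev := by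
    have := φ.direct_eq (φ.edge.symm j₀)
    rw [φ.edge.apply_symm_apply, hj₀] at this
    cases rev <;> simpa using this.symm
  have hσ : ∏ i, σ.coef i₀ lam i = (lam : k) := by simp [HomotopyBand.coef]
  have hτ : ∏ i, τ.coef j₀ mu (φ.edge i) = (mu : k) := by
    rw [Equiv.prod_comp φ.edge]
    simp [HomotopyBand.coef]
  have hσ' : ∀ i, (σ.letter i).direct = false → σ.coef i₀ lam i = 1 := fun i hi =>
    if_neg fun h => by simp [h, hi₀] at hi
  have hτ' : ∀ i, (σ.letter i).direct = rev → τ.coef j₀ mu (φ.edge i) = 1 := fun i hi =>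
    if_neg fun h => by simp [← h, hi] at hdir
  constructor
  · rintro rfl
    refine Units.ext ?_
    rw [← hσ, ← hτ]
    convert hprod using 2 with i _ i _
    · simp only [X]
      split_ifs with hi
      · rfl
      · rw [hσ' i (by simpa using hi), hτ' i (by simpa using hi)]
    · simp only [Y]
      split_ifs with hi
      · rfl
      · rw [hσ' i (by simpa using hi), hτ' i (by simpa using hi)]
  · rintro rfl
    refine eq_inv_of_mul_eq_one_left (Units.ext ?_)
    -- In opposite directions both scalars end up in `X`, and `Y` is trivial.
    have hX : ∀ i, X i = σ.coef i₀ lam i * τ.coef j₀ mu (φ.edge i) := by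
      intro i
      simp only [X]
      split_ifs with hi
      · rw [hτ' i hi, mul_one]
      · rw [hσ' i (by simpa using hi), one_mul]
    have hY : ∀ i, Y i = 1 := by
      intro i
      simp only [Y]
      split_ifs with hi
      · exact hτ' i hi
      · exact hσ' i (by simpa using hi)
    rw [Units.val_mul, Units.val_one, ← hσ, ← hτ, ← Finset.prod_mul_distrib,
      ← Finset.prod_congr rfl fun i _ => hX i, hprod, Finset.prod_eq_one fun i _ => hY i]

end

end Gentle

namespace Gentle

/-! ### Monomial maps between band complexes -/

section

variable {k : Type*} [Field k] {V A : Type*} [Fintype V] {Q : BoundQuiver V A}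

theorem coe_matHom_apply {ι κ : Type} [Fintype ι] {vert : ι → V} {deg : ι → ℤ} {vert' : κ → V}
    {deg' : κ → ℤ} (F : ι → κ → Alg k Q) (d d' : ℤ) (m : Part k Q vert deg d)
    (b : {b : κ // deg' b = d'}) :
    (matHom k Q (vert' := vert') (deg' := deg') F d d' m b : Alg k Q) =
      ∑ a : {a : ι // deg a = d}, (m a : Alg k Q) * (F a b * idem k Q (vert' b)) := by
  simp [matHom, rmul]

theorem mul_idem_of_mem_proj {x : V} (m : proj k Q x) : (m : Alg k Q) * idem k Q x = m := by
  obtain ⟨a, ha⟩ := Ideal.mem_span_singleton'.1 m.2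
  rw [← ha, mul_assoc, idem_mul_idem]

theorem idem_mem_proj (x : V) : idem k Q x ∈ proj k Q x := Ideal.subset_span rfl

open Classical in
/-- The monomial matrix with the entry `s a` in the place `(a, v a)`. -/
noncomputable def monomialMatrix {ι κ : Type} (vert : ι → V) (v : ι ≃ κ) (s : ι → k) (a : ι)
    (b : κ) : Alg k Q :=
  if b = v a then s a • idem k Q (vert a) else 0

/-- A single term of the matrix sum survives. The target index is a separate variable `b` with
`hab`, so that it can be used for `v` and for `v.symm` without transport along degree proofs. -/
theorem coe_matHom_monomialMatrix {ι κ : Type} [Fintype ι] {vert : ι → V} {deg : ι → ℤ}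
    {vert' : κ → V} {deg' : κ → ℤ} {v : ι ≃ κ} (hv : ∀ a, vert' (v a) = vert a) (s : ι → k)
    {d d' : ℤ} (m : Part k Q vert deg d) {a : ι} (ha : deg a = d) {b : κ} (hb : deg' b = d')
    (hab : v a = b) :
    (matHom k Q (vert' := vert') (deg' := deg') (monomialMatrix vert v s) d d' m ⟨b, hb⟩ :
      Alg k Q) = s a • (m ⟨a, ha⟩ : Alg k Q) := by
  classical
  subst hab
  rw [coe_matHom_apply, Finset.sum_eq_single ⟨a, ha⟩]
  · rw [monomialMatrix, if_pos rfl, hv, smul_mul_assoc, mul_smul_comm, idem_mul_idem,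
      mul_idem_of_mem_proj]
  · intro b _ hb'
    rw [monomialMatrix, if_neg, zero_mul, mul_zero]
    exact fun h => hb' (Subtype.ext (v.injective h.symm))
  · exact fun h => absurd (Finset.mem_univ _) h

theorem matHom_monomialMatrix_comp {ι κ : Type} [Fintype ι] [Fintype κ] {vert : ι → V}
    {deg : ι → ℤ} {vert' : κ → V} {deg' : κ → ℤ} {v : ι ≃ κ} (hv : ∀ a, vert' (v a) = vert a)
    {s : ι → k} (hs : ∀ a, s a ≠ 0) {d d' : ℤ} (hd : ∀ a, deg a = d → deg' (v a) = d') :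
    (matHom k Q (vert' := vert) (deg' := deg)
      (monomialMatrix vert' v.symm fun b => (s (v.symm b))⁻¹) d' d) ∘ₗ
      (matHom k Q (vert := vert) (vert' := vert') (deg' := deg') (monomialMatrix vert v s) d d') =
        LinearMap.id := by
  refine LinearMap.ext fun m => funext fun ⟨a, ha⟩ => Subtype.ext ?_
  obtain ⟨b, rfl⟩ := v.symm.surjective a
  have hv' : ∀ b, vert (v.symm b) = vert' b := fun b => by rw [← hv, v.apply_symm_apply]
  have hb : deg' b = d' := by simpa using hd _ ha
  rw [LinearMap.comp_apply, coe_matHom_monomialMatrix hv' _ _ hb _ rfl,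
    coe_matHom_monomialMatrix hv s m ha _ (v.apply_symm_apply b), smul_smul, inv_mul_cancel₀ (hs _), one_smul, LinearMap.id_apply]

/-- A monomial matrix with nonzero entries gives an isomorphism. -/
noncomputable def monomialEquiv {ι κ : Type} [Fintype ι] [Fintype κ] {vert : ι → V}
    {deg : ι → ℤ} {vert' : κ → V} {deg' : κ → ℤ} (v : ι ≃ κ) (hv : ∀ a, vert' (v a) = vert a)
    {s : ι → k} (hs : ∀ a, s a ≠ 0) {d d' : ℤ} (hd : ∀ a, deg a = d ↔ deg' (v a) = d') :
    Part k Q vert deg d ≃ₗ[Alg k Q] Part k Q vert' deg' d' :=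
  LinearEquiv.ofLinearMap (matHom k Q (monomialMatrix vert v s) d d')
    (matHom k Q (monomialMatrix vert' v.symm fun b => (s (v.symm b))⁻¹) d' d)
    (by
      -- The other composite is the same statement for `v.symm` and the inverted scalars.
      have h := matHom_monomialMatrix_comp (k := k) (Q := Q) (v := v.symm) (vert := vert')
        (vert' := vert) (deg := deg') (deg' := deg) (s := fun b => (s (v.symm b))⁻¹)
        (d := d') (d' := d)
        (fun b => by rw [← hv, v.apply_symm_apply]) (fun b => inv_ne_zero (hs _))
        (fun b hb => (hd _).2 (by rwa [v.apply_symm_apply]))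
      simpa using h)
    (matHom_monomialMatrix_comp hv hs fun a => (hd a).1)

/-! ### Aligned bands: square relations and isomorphisms of complexes -/

namespace Alignment

variable {σ τ : HomotopyBand Q} {rev : Bool} {s : ℤ}

/-- The square relations, summed over all letters from `a` to `b`, with the sum for `τ` reindexed by
`φ.edge`. -/
theorem diffMatrix_eq (φ : Alignment σ τ rev s) (i₀ : ZMod σ.len) {j₀ : ZMod τ.len} (lam : kˣ)
    {mu : kˣ} {S : ZMod σ.len → k} {η : k}
    (h : ∀ i, σ.coef i₀ lam i * S (σ.arrowTgt i) =
      η * (S (σ.arrowSrc i) * τ.coef j₀ mu (φ.edge i))) (a b : ZMod σ.len) :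
    S b • σ.diffMatrix i₀ lam a b =
      (η * S a) • τ.diffMatrix j₀ mu (φ.vertex a) (φ.vertex b) := by
  unfold HomotopyBand.diffMatrix
  rw [← Equiv.sum_comp φ.edge, Finset.smul_sum, Finset.smul_sum]
  refine Finset.sum_congr rfl fun i _ => ?_
  simp only [φ.arrowSrc_eq, φ.arrowTgt_eq, φ.vertex.apply_eq_iff_eq, φ.path_eq]
  split_ifs with hi
  · obtain ⟨rfl, rfl⟩ := hi
    rw [smul_smul, smul_smul, mul_comm, h, mul_assoc]
  · rw [smul_zero, smul_zero]

/-- The two ways round the square with monomial vertical maps. -/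
theorem coe_monomial_diff (φ : Alignment σ τ rev s) (i₀ : ZMod σ.len) (lam : kˣ)
    (S : ZMod σ.len → k) {i j j' : ℤ} (m : Part k Q σ.vert σ.deg i) {b : ZMod σ.len}
    (hb : σ.deg b = j) (hb' : τ.deg (φ.vertex b) = j') :
    (matHom k Q (vert' := τ.vert) (deg' := τ.deg) (monomialMatrix σ.vert φ.vertex S) j j'
      (matHom k Q (vert' := σ.vert) (deg' := σ.deg) (σ.diffMatrix i₀ lam) i j m)
        ⟨φ.vertex b, hb'⟩ : Alg k Q) =
      ∑ a : {a // σ.deg a = i}, (m a : Alg k Q) *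
        (S b • σ.diffMatrix i₀ lam a b) * idem k Q (σ.vert b) := by
  rw [coe_matHom_monomialMatrix φ.vert_eq S _ hb _ rfl, coe_matHom_apply, Finset.smul_sum]
  refine Finset.sum_congr rfl fun a _ => ?_
  rw [mul_smul_comm, smul_mul_assoc, mul_assoc]

theorem coe_diff_monomial (φ : Alignment σ τ rev s) (j₀ : ZMod τ.len) (mu : kˣ)
    (S : ZMod σ.len → k) {i i' j' : ℤ} (hi : i' + s = i) (m : Part k Q σ.vert σ.deg i)
    {b : ZMod σ.len} (hb' : τ.deg (φ.vertex b) = j') :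
    (matHom k Q (vert' := τ.vert) (deg' := τ.deg) (τ.diffMatrix j₀ mu) i' j'
      (matHom k Q (vert' := τ.vert) (deg' := τ.deg) (monomialMatrix σ.vert φ.vertex S) i i' m)
        ⟨φ.vertex b, hb'⟩ : Alg k Q) =
      ∑ a : {a // σ.deg a = i}, (m a : Alg k Q) *
        (S a • τ.diffMatrix j₀ mu (φ.vertex a) (φ.vertex b)) * idem k Q (σ.vert b) := by
  -- Vertices of degree `i` in `σ` correspond to those of degree `i'` in `τ`, so the sum can be
  -- reindexed within one degree.
  have hd : ∀ a, σ.deg a = i ↔ τ.deg (φ.vertex a) = i' := fun a => by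
    have := φ.deg_eq a
    omega
  rw [coe_matHom_apply, ← Equiv.sum_comp (φ.vertex.subtypeEquiv hd)]
  refine Finset.sum_congr rfl fun a _ => ?_
  have h := coe_matHom_monomialMatrix (k := k) (Q := Q) (deg := σ.deg) (deg' := τ.deg) φ.vert_eq S
    m a.2 ((hd a).1 a.2) rfl
  rw [Equiv.subtypeEquiv_apply, h, φ.vert_eq, mul_smul_comm, smul_mul_assoc, smul_mul_assoc,
    mul_assoc]

/-- A monomial chain map satisfies the square relations. -/
theorem coef_eq_of_comm (φ : Alignment σ τ rev 0) {i₀ : ZMod σ.len} {j₀ : ZMod τ.len} {lam mu : kˣ}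
    {S : ZMod σ.len → k} (f : σ.complex i₀ lam ⟶ τ.complex j₀ mu)
    (hf : ∀ d, f.f d = ModuleCat.ofHom (matHom k Q (vert := σ.vert) (deg := σ.deg)
      (vert' := τ.vert) (deg' := τ.deg) (monomialMatrix σ.vert φ.vertex S) d d))
    (e : ZMod σ.len) :
    σ.coef i₀ lam e * S (σ.arrowTgt e) =
      1 * (S (σ.arrowSrc e) * τ.coef j₀ mu (φ.edge e)) := by
  classical
  set a := σ.arrowSrc e with ha
  set b := σ.arrowTgt e with hb
  have hdeg : τ.deg (φ.vertex b) = σ.deg b := by simpa using φ.deg_eq b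
  -- The generator of the summand at `a`: evaluating the commuting square on it isolates one matrix
  -- entry.
  let m : Part k Q σ.vert σ.deg (σ.deg a) := Pi.single ⟨a, rfl⟩ ⟨_, idem_mem_proj (σ.vert a)⟩
  have hm : ∀ G : ZMod σ.len → Alg k Q, ∑ a' : {a' // σ.deg a' = σ.deg a},
      (m a' : Alg k Q) * G a' * idem k Q (σ.vert b) =
        idem k Q (σ.vert a) * G a * idem k Q (σ.vert b) := by
    intro G
    rw [Finset.sum_eq_single ⟨a, rfl⟩]
    · simp [m]
    · intro a' _ ha'
      simp [m, Pi.single_eq_of_ne ha']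
    · exact fun h => absurd (Finset.mem_univ _) h
  have hcomm := f.comm (σ.deg a) (σ.deg b)
  rw [hf, hf] at hcomm
  have h1 := congrArg (fun g => (g.hom m : Part k Q τ.vert τ.deg (σ.deg b)) ⟨φ.vertex b, hdeg⟩)
    hcomm
  have h2 := congrArg Subtype.val h1
  have h3 := (φ.coe_diff_monomial j₀ mu S (add_zero (σ.deg a)) m hdeg).symm.trans
    (h2.trans (φ.coe_monomial_diff i₀ lam S m rfl hdeg))
  rw [hm (fun a' => S a' • τ.diffMatrix j₀ mu (φ.vertex a') (φ.vertex b)),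
    hm (fun a' => S b • σ.diffMatrix i₀ lam a' b)] at h3
  have h4 := σ.idem_mul_diffMatrix_mul_idem i₀ lam a b
  have h5 := τ.idem_mul_diffMatrix_mul_idem j₀ mu (φ.vertex a) (φ.vertex b)
  rw [φ.vert_eq, φ.vert_eq] at h5
  rw [mul_smul_comm, smul_mul_assoc, h5, mul_smul_comm, smul_mul_assoc, h4] at h3
  -- Taking the coefficient of the path of `e` turns the equation in `Λ` into one between scalars.
  have h6 := congrArg (pathCoef (σ.vert b) (σ.letter e).path) h3
  have h7 := τ.pathCoef_diffMatrix j₀ mu (φ.edge e)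
  rw [φ.arrowSrc_eq, φ.arrowTgt_eq, φ.vert_eq, φ.path_eq] at h7
  rw [map_smul, map_smul, ha, hb, h7, σ.pathCoef_diffMatrix, smul_eq_mul, smul_eq_mul] at h6
  rw [one_mul, h6, mul_comm]

/-- The isomorphism of complexes given by scalars satisfying the square relations. -/
noncomputable def complexIso (φ : Alignment σ τ rev 1) {i₀ : ZMod σ.len} {j₀ : ZMod τ.len}
    {lam mu : kˣ} {S : ZMod σ.len → k} (hS : ∀ a, S a ≠ 0)
    (h : ∀ i, σ.coef i₀ lam i * S (σ.arrowTgt i) =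
      -1 * (S (σ.arrowSrc i) * τ.coef j₀ mu (φ.edge i))) :
    σ.complex i₀ lam ≅ (shiftFunctor (CochainComplex (ModuleCat (Alg k Q)) ℤ) (-1 : ℤ)).obj
      (τ.complex j₀ mu) :=
  HomologicalComplex.Hom.isoOfComponents
    (fun d => LinearEquiv.toModuleIso (monomialEquiv (k := k) (Q := Q) (deg := σ.deg)
      (deg' := τ.deg) (d := d) (d' := d + -1) φ.vertex φ.vert_eq hS
      (fun a => by have := φ.deg_eq a; omega)))
    (by
      intro i j _
      refine ModuleCat.hom_ext (LinearMap.ext fun m => funext fun ⟨b', hb'⟩ => Subtype.ext ?_)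
      obtain ⟨b, rfl⟩ := φ.vertex.surjective b'
      have hdeg := φ.deg_eq b
      have hb : σ.deg b = j := by
        change τ.deg _ = j + -1 at hb'
        omega
      refine Eq.trans ?_ (φ.coe_monomial_diff i₀ lam S m hb hb').symm
      have h1 := φ.coe_diff_monomial j₀ mu S (i' := i + -1) (by omega) m hb'
      -- The shift by `-1` multiplies the differential by `-1`, which matches the factor `-1` in
      -- `h`.
      rw [CochainComplex.shiftFunctor_obj_d']
      simp only [Int.negOnePow_neg, Int.negOnePow_one, Units.neg_smul, one_smul]
      refine Eq.trans (congrArg Neg.neg h1) ?_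
      rw [← Finset.sum_neg_distrib]
      refine Finset.sum_congr rfl fun a _ => ?_
      rw [φ.diffMatrix_eq i₀ lam h]
      have hneg : ∀ (x u e : Alg k Q) (t : k), -(x * (t • u) * e) = x * ((-1 * t) • u) * e := by
        intro x u e t
        rw [neg_one_mul, mul_smul_comm, smul_mul_assoc, mul_smul_comm, smul_mul_assoc]
        exact (neg_smul t (x * u * e)).symm
      exact hneg _ _ _ _)

end Alignment

/-- The matrix of the vertical isomorphisms over an overlap which is the whole word is monomial. -/
theorem IsVertical.eq_monomialMatrix {σ τ : HomotopyBand Q} {rev : Bool} {s : ℤ}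
    (φ : Alignment σ τ rev s) {i₀ : ZMod σ.len} {lam : kˣ} {E : Unfolded k Q (ZMod τ.len)}
    {S : ZMod σ.len → ZMod τ.len → k} (hφ : ∀ i : ℤ, φ.vertex i = E.pos i)
    (h : IsVertical (σ.unfold i₀ lam false 0) E Set.univ S) :
    (∀ a, S a (φ.vertex a) ≠ 0) ∧ (fun a b => S a b • idem k Q (σ.vert a)) =
      monomialMatrix σ.vert φ.vertex fun a => S a (φ.vertex a) := by
  constructor
  · intro a
    obtain ⟨i, rfl⟩ := ZMod.intCast_surjective a
    have := h.ne_zero i trivial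
    rwa [← hφ, show (σ.unfold i₀ lam false 0).pos i = i by simp [HomotopyBand.unfold]] at this
  · funext a b
    unfold monomialMatrix
    split_ifs with hb
    · rw [hb]
    · have : S a b = 0 := by
        by_contra hne
        obtain ⟨i, -, hi, rfl⟩ := h.support a b hne
        rw [show (σ.unfold i₀ lam false 0).pos i = i by simp [HomotopyBand.unfold]] at hi
        exact hb (by rw [← hi, hφ])
      rw [this, zero_smul]

end

end Gentle

/-! ### Graph maps and quasi-graph maps determined by infinite overlaps -/

theorem corollary1p4 {k : Type*} [Field k] {V A : Type*} [Fintype V] [Fintype A]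
    (Q : Gentle.BoundQuiver V A) (hQ : Q.IsGentle)
    [HasDerivedCategory (ModuleCat (Gentle.Alg k Q))]
    (σ τ : Gentle.HomotopyBand Q)
    (i₀ : ZMod σ.len) (hi₀ : (σ.letter i₀).direct = true)
    (j₀ : ZMod τ.len) (hj₀ : (τ.letter j₀).direct = true)
    (lam mu : kˣ) :
    (∀ (f : σ.complex i₀ lam ⟶ τ.complex j₀ mu) (rev : Bool) (c : ℤ) (J : Set ℤ),
      J.Infinite → Gentle.IsGraphMap f rev c J →
        IsIso (DerivedCategory.Q.map f) ∧
        (rev = false → lam = mu) ∧ (rev = true → lam = mu⁻¹)) ∧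
    (∀ (rev : Bool) (c : ℤ) (J : Set ℤ) (S : ZMod σ.len → ZMod τ.len → k),
      J.Infinite →
      Gentle.IsQuasiGraphMap (σ.unfold i₀ lam false 0) (τ.unfold j₀ mu rev c).desuspend J S →
        Nonempty (DerivedCategory.Q.obj (σ.complex i₀ lam) ≅
          (shiftFunctor (DerivedCategory (ModuleCat (Gentle.Alg k Q))) (-1 : ℤ)).obj
            (DerivedCategory.Q.obj (τ.complex j₀ mu))) ∧
        (rev = false → lam = mu) ∧ (rev = true → lam = mu⁻¹)) := by
  refine ⟨fun f rev c J hJ ⟨hov, S, L, R, hS, hL, hR, hf⟩ => ?_, fun rev c J S hJ h => ?_⟩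
  · obtain ⟨rfl, hl⟩ := Gentle.eq_univ_and_letter_eq hJ rfl hov
    obtain ⟨φ, hφ⟩ := Gentle.exists_alignment (s := 0) hl
      fun i => by rw [hov.deg_eq i trivial, add_zero]
    obtain ⟨hS0, hSm⟩ := hS.eq_monomialMatrix φ fun i => (hφ i).1
    -- The overlap is the whole line, so there are no end components.
    have hL0 : L = 0 := hL.2 fun _ _ => trivial
    have hR0 : R = 0 := hR.2 fun _ _ => trivial
    have hf' : ∀ d, f.f d = ModuleCat.ofHom (Gentle.matHom k Q (vert := σ.vert) (deg := σ.deg)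
        (vert' := τ.vert) (deg' := τ.deg)
        (Gentle.monomialMatrix σ.vert φ.vertex fun a => S a (φ.vertex a)) d d) := by
      intro d
      rw [hf, ← hSm, hL0, hR0]
      simp only [Pi.zero_apply, add_zero]
      rfl
    refine ⟨?_, φ.scalar_eq hi₀ hj₀ hS0 (one_mul 1) (φ.coef_eq_of_comm f hf')⟩
    -- Invertible in each degree, `f` is an isomorphism before passing to the derived category.
    have hiso : ∀ d, IsIso (f.f d) := by
      intro d
      rw [hf' d]
      let e : (σ.complex i₀ lam).X d ≅ (τ.complex j₀ mu).X d :=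
        LinearEquiv.toModuleIso (Gentle.monomialEquiv (k := k) (Q := Q) (deg := σ.deg)
          (deg' := τ.deg) (d := d) (d' := d) φ.vertex φ.vert_eq hS0
          (fun a => by rw [← φ.deg_eq a, add_zero]))
      exact e.isIso_hom
    have := HomologicalComplex.Hom.isIso_of_components f
    infer_instance
  · obtain ⟨rfl, hl⟩ := Gentle.eq_univ_and_letter_eq (j₀ := j₀) (mu := mu) (rev := rev) (c := c) hJ
      (E := (τ.unfold j₀ mu rev c).desuspend) rfl h.overlap
    -- Desuspension raises the degrees of `τ` by one, hence the shift `1`.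
    obtain ⟨φ, hφ⟩ := Gentle.exists_alignment (s := 1) hl
      fun i => h.overlap.deg_eq i trivial
    obtain ⟨hS0, -⟩ := Gentle.IsVertical.eq_monomialMatrix φ
      (E := (τ.unfold j₀ mu rev c).desuspend) (fun i => (hφ i).1) h.vertical
    -- The factor `-1` is the sign of the desuspended coefficients.
    have hsq : ∀ e, σ.coef i₀ lam e * S (σ.arrowTgt e) (φ.vertex (σ.arrowTgt e)) =
        -1 * (S (σ.arrowSrc e) (φ.vertex (σ.arrowSrc e)) * τ.coef j₀ mu (φ.edge e)) := by
      intro e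
      obtain ⟨i, rfl⟩ := ZMod.intCast_surjective e
      have h1 := h.square i trivial trivial
      have hp : ∀ i : ℤ, (τ.unfold j₀ mu rev c).desuspend.pos i = φ.vertex i :=
        fun i => (hφ i).1.symm
      have hc : (τ.unfold j₀ mu rev c).desuspend.coef i = -τ.coef j₀ mu (φ.edge i) :=
        congrArg Neg.neg (hφ i).2.symm
      rw [hp, hp, hc] at h1
      simp only [Gentle.HomotopyBand.unfold, zero_add, Int.cast_add, Int.cast_one] at h1
      unfold Gentle.HomotopyBand.arrowSrc Gentle.HomotopyBand.arrowTgt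
      split_ifs at h1 ⊢
      · rw [h1]
        ring
      · rw [h1]
        ring
    exact ⟨⟨DerivedCategory.Q.mapIso (φ.complexIso hS0 hsq) ≪≫
      (DerivedCategory.Q.commShiftIso (-1 : ℤ)).app _⟩,
      φ.scalar_eq hi₀ hj₀ hS0 (by ring) hsq⟩
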